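/- Let $P:\mathbb C\to\mathbb C$ be a complex polynomial of degree $d\ge 2$, and let $z_0\in\mathbb C$ be an attracting fixed point of $P$, i.e. $P(z_0)=z_0$ and $|P'(z_0)|<1$ (the superattracting case $P'(z_0)=0$ is included). Let $U=\{z\in\mathbb C : P^n(z)\to z_0 \text{ as } n\to\infty\}$ be the basin of attraction of $z_0$, where $P^n$ denotes the $n$-th iterate of $P$, and let the immediate basin of attraction $U_0$ be the connected component of $U$ containing $z_0$. Then $U_0$ contains a critical point of $P$: there is $c\in U_0$ with $P'(c)=0$. -/

import Mathlib

open Filter Topology Polynomial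

namespace PolyDyn

/-- `z₀ ∈ ℂ` is an attracting fixed point of the polynomial `P`:
`P(z₀) = z₀` and the multiplier `P'(z₀)` has modulus less than one. -/
def IsAttractingFixedPoint (P : ℂ[X]) (z₀ : ℂ) : Prop :=
  P.eval z₀ = z₀ ∧ ‖deriv (fun z => P.eval z) z₀‖ < 1

/-- `z ∈ ℂ` is a (finite) critical point of `P`: `P'(z) = 0`. -/
def IsCriticalPoint (P : ℂ[X]) (z : ℂ) : Prop :=
  deriv (fun w => P.eval w) z = 0

/-- The basin of attraction of `z₀`: the points whose orbit under `P` converges to `z₀`. -/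
def basin (P : ℂ[X]) (z₀ : ℂ) : Set ℂ :=
  {z | Tendsto (fun n : ℕ => (fun w => P.eval w)^[n] z) atTop (𝓝 z₀)}

/-- A fixed point lies in its own basin, so its component below is the genuine one. -/
theorem mem_basin_self {P : ℂ[X]} {z₀ : ℂ} (h : P.eval z₀ = z₀) : z₀ ∈ basin P z₀ := by
  have h' : ∀ n : ℕ, (fun w => P.eval w)^[n] z₀ = z₀ := fun n =>
    Function.iterate_fixed h n
  simp [basin, h']

/-- The immediate basin of attraction: the connected component of the basin containing `z₀`. -/
def immediateBasin (P : ℂ[X]) (z₀ : ℂ) : Set ℂ :=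
  connectedComponentIn (basin P z₀) z₀

end PolyDyn

namespace PolyDyn

open Set Metric

variable {P : ℂ[X]} {z₀ : ℂ}

/-! Suppose the immediate basin `U₀` has no critical point. Then `P : U₀ → U₀` is a covering, and
discs are simply connected, so on a fixed disc about `z₀` in `U₀` every iterate of `P` has a
holomorphic inverse branch fixing `z₀` with values in `U₀`. Its derivative at `z₀` is `P'(z₀)⁻ⁿ`,
unbounded in `n`; but `U₀` is bounded, so Cauchy's estimate bounds these derivatives uniformly. -/

theorem eval_mem_basin_iff {z : ℂ} : P.eval z ∈ basin P z₀ ↔ z ∈ basin P z₀ := by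
  change Tendsto (fun n : ℕ => (fun w => P.eval w)^[n + 1] z) atTop (𝓝 z₀) ↔ _
  exact tendsto_add_atTop_iff_nat (f := fun n : ℕ => (fun w => P.eval w)^[n] z) 1

theorem IsAttractingFixedPoint.basin_mem_nhds (h : IsAttractingFixedPoint P z₀) :
    basin P z₀ ∈ 𝓝 z₀ := by
  obtain ⟨hfix, hlt⟩ := h
  have hs : HasStrictDerivAt (fun z => P.eval z) (deriv (fun z => P.eval z) z₀) z₀ := by
    rw [Polynomial.deriv]
    exact P.hasStrictDerivAt z₀
  obtain ⟨k, hk, hk1⟩ := exists_between hlt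
  have hk0 : 0 ≤ k := (norm_nonneg _).trans hk.le
  lift k to NNReal using hk0
  obtain ⟨s, hs, hL⟩ := hs.hasStrictFDerivAt.exists_lipschitzOnWith_of_nnnorm_lt k
    (by rw [← NNReal.coe_lt_coe]; simpa using hk)
  obtain ⟨r, hr, hrs⟩ := Metric.mem_nhds_iff.1 hs
  refine Filter.mem_of_superset (ball_mem_nhds z₀ hr) fun z hz => ?_
  have key : ∀ n : ℕ, dist ((fun w => P.eval w)^[n] z) z₀ ≤ (k : ℝ) ^ n * dist z z₀ := by
    intro n
    induction n with
    | zero => simp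
    | succ n ih =>
      have hmem : (fun w => P.eval w)^[n] z ∈ ball z₀ r := by
        refine mem_ball.2 ((ih.trans ?_).trans_lt (mem_ball.1 hz))
        exact mul_le_of_le_one_left dist_nonneg (pow_le_one₀ k.2 hk1.le)
      have := hL.dist_le_mul _ (hrs hmem) _ (mem_of_mem_nhds hs)
      rw [Function.iterate_succ_apply']
      simp only [hfix] at this
      refine this.trans ?_
      rw [pow_succ', mul_assoc]
      exact mul_le_mul_of_nonneg_left ih k.2
  refine tendsto_iff_dist_tendsto_zero.2
    (squeeze_zero (fun _ => dist_nonneg) key ?_)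
  simpa using (tendsto_pow_atTop_nhds_zero_of_lt_one k.2 hk1).mul_const (dist z z₀)

theorem continuous_iterate_eval (P : ℂ[X]) (n : ℕ) : Continuous (fun w => P.eval w)^[n] :=
  P.continuous.iterate n

theorem iterate_eval_mem_basin_iff {z : ℂ} (n : ℕ) :
    (fun w => P.eval w)^[n] z ∈ basin P z₀ ↔ z ∈ basin P z₀ := by
  induction n with
  | zero => rfl
  | succ n ih => rw [Function.iterate_succ_apply', eval_mem_basin_iff, ih]

theorem IsAttractingFixedPoint.isOpen_basin (h : IsAttractingFixedPoint P z₀) :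
    IsOpen (basin P z₀) := by
  refine isOpen_iff_mem_nhds.2 fun z hz => ?_
  obtain ⟨n, hn⟩ := (hz.eventually (eventually_mem_nhds_iff.2 h.basin_mem_nhds)).exists
  filter_upwards [(continuous_iterate_eval P n).continuousAt hn] with w hw
  exact (iterate_eval_mem_basin_iff n).1 hw

/-- Writing `P = Q * X + C c` with `Q` nonconstant gives `‖P z‖ ≥ ‖z‖` far out, so an orbit starting
beyond both that radius and `‖z₀‖` cannot come back to `z₀`. -/
theorem isBounded_basin (hP : 2 ≤ P.natDegree) : Bornology.IsBounded (basin P z₀) := by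
  have hQ : 0 < P.divX.degree := by
    rw [← natDegree_pos_iff_degree_pos, natDegree_divX_eq_natDegree_tsub_one]
    omega
  have hlim := P.divX.tendsto_norm_atTop hQ (tendsto_norm_cocompact_atTop (E := ℂ))
  have hev := (hlim.eventually_ge_atTop (1 + ‖P.coeff 0‖)).and
    (tendsto_norm_cocompact_atTop.eventually_ge_atTop (1 : ℝ))
  rw [← Metric.cobounded_eq_cocompact, ← comap_norm_atTop, eventually_comap,
    eventually_atTop] at hev
  obtain ⟨R, hR⟩ := hev
  have hexp : ∀ z : ℂ, R ≤ ‖z‖ → ‖z‖ ≤ ‖P.eval z‖ := by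
    intro z hz
    obtain ⟨h1, h2⟩ := hR _ hz z rfl
    have hPz : P.eval z = P.divX.eval z * z + P.coeff 0 := by
      conv_lhs => rw [← P.divX_mul_X_add]
      simp
    have h3 : ‖P.divX.eval z * z‖ - ‖P.coeff 0‖ ≤ ‖P.eval z‖ := by
      rw [hPz]
      simpa using norm_sub_norm_le (P.divX.eval z * z) (-P.coeff 0)
    rw [norm_mul] at h3
    nlinarith [norm_nonneg (P.coeff 0)]
  refine (Metric.isBounded_closedBall (x := (0 : ℂ)) (r := max R ‖z₀‖)).subset fun z hz => ?_
  rw [mem_closedBall_zero_iff]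
  by_contra! hlt
  have key : ∀ n : ℕ, ‖z‖ ≤ ‖(fun w => P.eval w)^[n] z‖ := by
    intro n
    induction n with
    | zero => rfl
    | succ n ih =>
      rw [Function.iterate_succ_apply']
      exact ih.trans (hexp _ (((le_max_left _ _).trans hlt.le).trans ih))
  exact absurd (ge_of_tendsto' hz.norm key) (not_le.2 ((le_max_right _ _).trans_lt hlt))

theorem immediateBasin_subset_basin : immediateBasin P z₀ ⊆ basin P z₀ :=
  connectedComponentIn_subset _ _

theorem mem_immediateBasin_self (h : P.eval z₀ = z₀) : z₀ ∈ immediateBasin P z₀ :=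
  mem_connectedComponentIn (mem_basin_self h)

theorem IsAttractingFixedPoint.isOpen_immediateBasin (h : IsAttractingFixedPoint P z₀) :
    IsOpen (immediateBasin P z₀) :=
  h.isOpen_basin.connectedComponentIn

/-- Components of the open basin are open, so the component of such a point meets `U₀` and hence
equals it. -/
theorem IsAttractingFixedPoint.closure_immediateBasin_inter_basin_subset
    (h : IsAttractingFixedPoint P z₀) :
    closure (immediateBasin P z₀) ∩ basin P z₀ ⊆ immediateBasin P z₀ := by
  rintro z ⟨hz, hzU⟩
  obtain ⟨w, hw, hw'⟩ := mem_closure_iff.1 hz _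
    (h.isOpen_basin.connectedComponentIn (x := z)) (mem_connectedComponentIn hzU)
  rw [immediateBasin, connectedComponentIn_eq hw', ← connectedComponentIn_eq hw]
  exact mem_connectedComponentIn hzU

theorem mapsTo_eval_immediateBasin (h : P.eval z₀ = z₀) :
    MapsTo (fun z => P.eval z) (immediateBasin P z₀) (immediateBasin P z₀) := by
  refine mapsTo_iff_image_subset.2 ?_
  refine (isPreconnected_connectedComponentIn.image _ P.continuous.continuousOn
    ).subset_connectedComponentIn ⟨z₀, mem_immediateBasin_self h, h⟩ ?_
  rintro _ ⟨z, hz, rfl⟩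
  exact eval_mem_basin_iff.2 (immediateBasin_subset_basin hz)

/-- The restriction of a polynomial to the immediate basin of a fixed point. -/
def immediateBasinMap (h : P.eval z₀ = z₀) : immediateBasin P z₀ → immediateBasin P z₀ :=
  (mapsTo_eval_immediateBasin h).restrict _ _ _

/-- `P` is closed on `ℂ`, and a point of the closure of `U₀` sent into `U₀` lies in the basin, hence
already in `U₀`. -/
theorem IsAttractingFixedPoint.isClosedMap_immediateBasinMap (h : IsAttractingFixedPoint P z₀) :
    IsClosedMap (immediateBasinMap h.1) := by
  intro s hs
  obtain ⟨Z, hZ, rfl⟩ := isClosed_induced_iff.1 hs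
  refine isClosed_induced_iff.2
    ⟨_, P.isClosedMap_eval _ (hZ.inter (isClosed_closure (s := immediateBasin P z₀))), ?_⟩
  ext w
  constructor
  · rintro ⟨z, ⟨hzZ, hz⟩, hzw⟩
    have hzU : z ∈ basin P z₀ :=
      eval_mem_basin_iff.1 (mem_of_eq_of_mem hzw (immediateBasin_subset_basin w.2))
    exact ⟨⟨z, h.closure_immediateBasin_inter_basin_subset ⟨hz, hzU⟩⟩, hzZ, Subtype.ext hzw⟩
  · rintro ⟨z, hzZ, rfl⟩
    exact ⟨z, ⟨hzZ, subset_closure z.2⟩, rfl⟩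

/-- A closed local homeomorphism with finite fibres is a covering. -/
theorem IsAttractingFixedPoint.isCoveringMap_immediateBasinMap
    (h : IsAttractingFixedPoint P z₀) (hP : 0 < P.natDegree)
    (hcrit : ∀ c ∈ immediateBasin P z₀, P.derivative.eval c ≠ 0) :
    IsCoveringMap (immediateBasinMap h.1) := by
  rw [isCoveringMap_iff_isCoveringMapOn_univ]
  refine h.isClosedMap_immediateBasinMap.isCoveringMapOn_of_isLocalHomeomorphOn
    (fun w _ => ?_) (IsLocalHomeomorph.isLocalHomeomorphOn ?_ (s := _))
  · have hne : P ≠ C (w : ℂ) := by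
      rintro hPC
      rw [hPC, natDegree_C] at hP
      exact hP.false
    have hfin : ((fun z => P.eval z) ⁻¹' {(w : ℂ)}).Finite := by
      rw [preimage_eval_singleton hne]
      exact rootSet_finite _ _
    refine (hfin.preimage (Subtype.val_injective.injOn (s := _))).subset fun z hz => ?_
    exact congrArg Subtype.val hz
  · have hsub : IsLocalHomeomorph (Subtype.val : immediateBasin P z₀ → ℂ) :=
      h.isOpen_immediateBasin.isOpenEmbedding_subtypeVal.isLocalHomeomorph
    have hloc : IsLocalHomeomorphOn (fun z => P.eval z) (immediateBasin P z₀) := fun z hz =>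
      ⟨_, ((P.hasStrictDerivAt z).hasStrictFDerivAt_equiv
        (hcrit z hz)).mem_toOpenPartialHomeomorph_source, by simp⟩
    refine IsLocalHomeomorph.of_comp (g := Subtype.val) ?_ hsub
      ((P.continuous.comp continuous_subtype_val).subtype_mk _)
    rw [isLocalHomeomorph_iff_isLocalHomeomorphOn_univ] at hsub ⊢
    exact hloc.comp hsub fun z _ => z.2

/-- Without critical points in the immediate basin, every holomorphic map from a disc centered at
the fixed point to the immediate basin lifts through the polynomial. -/
theorem IsAttractingFixedPoint.exists_lift (h : IsAttractingFixedPoint P z₀)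
    (hP : 0 < P.natDegree) (hcrit : ∀ c ∈ immediateBasin P z₀, P.derivative.eval c ≠ 0)
    {r : ℝ} (hr : 0 < r) {g : ℂ → ℂ} (hg : DifferentiableOn ℂ g (ball z₀ r))
    (hmaps : MapsTo g (ball z₀ r) (immediateBasin P z₀)) (hg₀ : g z₀ = z₀) :
    ∃ G : ℂ → ℂ, DifferentiableOn ℂ G (ball z₀ r) ∧
      MapsTo G (ball z₀ r) (immediateBasin P z₀) ∧ G z₀ = z₀ ∧
      deriv G z₀ = deriv g z₀ / P.derivative.eval z₀ := by
  have hz₀ : z₀ ∈ ball z₀ r := mem_ball_self hr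
  have : LocallyPathConnectedSpace (ball z₀ r) := isOpen_ball.locallyPathConnectedSpace
  have : ContractibleSpace (ball z₀ r) :=
    (convex_ball z₀ r).contractibleSpace ⟨z₀, hz₀⟩
  obtain ⟨F, ⟨hF₀, hF⟩, -⟩ :=
    (h.isCoveringMap_immediateBasinMap hP hcrit).existsUnique_continuousMap_lifts
      ⟨hmaps.restrict _ _ _, hg.continuousOn.mapsToRestrict hmaps⟩ ⟨z₀, hz₀⟩
      ⟨z₀, mem_immediateBasin_self h.1⟩
      (Subtype.ext (by simpa [immediateBasinMap, hg₀] using h.1))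
  classical
  let G : ℂ → ℂ := fun z => if hz : z ∈ ball z₀ r then F ⟨z, hz⟩ else 0
  have hG : ∀ z (hz : z ∈ ball z₀ r), G z = F ⟨z, hz⟩ := fun z hz => dif_pos hz
  have hGmaps : MapsTo G (ball z₀ r) (immediateBasin P z₀) := fun z hz => by
    rw [hG z hz]
    exact (F ⟨z, hz⟩).2
  have hPG : ∀ z ∈ ball z₀ r, P.eval (G z) = g z := fun z hz => by
    rw [hG z hz]
    exact congrArg Subtype.val (congrFun hF ⟨z, hz⟩)
  have hGcont : ContinuousOn G (ball z₀ r) := by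
    rw [continuousOn_iff_continuous_domRestrict]
    refine (continuous_subtype_val.comp F.continuous).congr fun z => ?_
    exact (hG z z.2).symm
  -- A continuous lift is automatically holomorphic, since `P'` does not vanish on `U₀`.
  have hderiv : ∀ z ∈ ball z₀ r,
      HasDerivAt G (deriv g z / P.derivative.eval (G z)) z := fun z hz =>
    (P.hasDerivAt (G z)).of_comp_left (hGcont.continuousAt (isOpen_ball.mem_nhds hz))
      (hg.differentiableAt (isOpen_ball.mem_nhds hz)).hasDerivAt (hcrit _ (hGmaps hz))
      (Filter.mem_of_superset (isOpen_ball.mem_nhds hz) hPG)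
  have hG₀ : G z₀ = z₀ := by rw [hG z₀ hz₀, hF₀]
  refine ⟨G, fun z hz => (hderiv z hz).differentiableAt.differentiableWithinAt, hGmaps, hG₀, ?_⟩
  rw [(hderiv z₀ hz₀).deriv, hG₀]

theorem IsAttractingFixedPoint.exists_inverse_branch (h : IsAttractingFixedPoint P z₀)
    (hP : 0 < P.natDegree) (hcrit : ∀ c ∈ immediateBasin P z₀, P.derivative.eval c ≠ 0)
    {r : ℝ} (hr : 0 < r) (hball : ball z₀ r ⊆ immediateBasin P z₀) (n : ℕ) :
    ∃ g : ℂ → ℂ, DifferentiableOn ℂ g (ball z₀ r) ∧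
      MapsTo g (ball z₀ r) (immediateBasin P z₀) ∧ g z₀ = z₀ ∧
      deriv g z₀ = (P.derivative.eval z₀)⁻¹ ^ n := by
  induction n with
  | zero => exact ⟨id, differentiableOn_id, hball, rfl, by simp⟩
  | succ n ih =>
    obtain ⟨g, hg, hmaps, hg₀, hd⟩ := ih
    obtain ⟨G, hG, hGmaps, hG₀, hGd⟩ := h.exists_lift hP hcrit hr hg hmaps hg₀
    exact ⟨G, hG, hGmaps, hG₀, by rw [hGd, hd, pow_succ, div_eq_mul_inv]⟩

end PolyDyn

theorem mainTheorem5 (P : Polynomial ℂ) (hP : 2 ≤ P.natDegree) (z₀ : ℂ)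
    (hz₀ : PolyDyn.IsAttractingFixedPoint P z₀) :
    ∃ c ∈ PolyDyn.immediateBasin P z₀, PolyDyn.IsCriticalPoint P c := by
  simp only [PolyDyn.IsCriticalPoint, Polynomial.deriv]
  by_contra! hcrit
  have hmem := PolyDyn.mem_immediateBasin_self hz₀.1
  obtain ⟨r, hr, hball⟩ := Metric.isOpen_iff.1 hz₀.isOpen_immediateBasin z₀ hmem
  obtain ⟨R, hR⟩ := ((PolyDyn.isBounded_basin hP).subset
    PolyDyn.immediateBasin_subset_basin).exists_norm_le
  have hlt : ‖P.derivative.eval z₀‖ < 1 := by simpa using hz₀.2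
  have hone : 1 < ‖P.derivative.eval z₀‖⁻¹ :=
    (one_lt_inv₀ (norm_pos_iff.2 (hcrit z₀ hmem))).2 hlt
  -- `R / (r / 2)` is the Cauchy bound on the circle of radius `r / 2`.
  obtain ⟨n, hn⟩ := pow_unbounded_of_one_lt (R / (r / 2)) hone
  obtain ⟨g, hg, hmaps, -, hd⟩ := hz₀.exists_inverse_branch (by omega) hcrit hr hball n
  have hsub : Metric.closedBall z₀ (r / 2) ⊆ Metric.ball z₀ r :=
    Metric.closedBall_subset_ball (half_lt_self hr)
  have hcauchy := Complex.norm_deriv_le_of_forall_mem_sphere_norm_le (half_pos hr)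
    (hg.diffContOnCl_ball hsub)
    fun z hz => hR _ (hmaps (hsub (Metric.sphere_subset_closedBall hz)))
  rw [hd, norm_pow, norm_inv] at hcauchy
  exact hcauchy.not_gt hn
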